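/- Setting. Let $\mathcal X_1,\mathcal X_2,\mathcal U$ be finite alphabets, $p(x_1,x_2)$ a joint pmf, $p(u|x_1,x_2)$ a conditional pmf, and let $((X_1,X_2),U)$ have the joint law $p(x_1,x_2)p(u|x_1,x_2)$. Entropies and mutual informations are in bits. Let $M\ge 0$ be the cache capacity. The library consists of two files $X_1^n,X_2^n$, where the pairs $(X_{1t},X_{2t})$, $t=1,\dots,n$, are i.i.d. with law $p(x_1,x_2)$. Write $[1:2^{a})=\{1,\dots,2^{\lfloor a\rfloor}\}$ (with $\lfloor a\rfloor$ replaced by $0$ if $a<0$). Let $\mathcal R_{GW}(U)$ be the set of triples $(R_0,R_1,R_2)$ with $R_0\ge I(X_1,X_2;U)$, $R_1\ge H(X_1|U)$ and $R_2\ge H(X_2|U)$. A Gray-Wyner cache-aided coded multicast (GW-CACM) scheme of block length $n$ and description rates $(R_0,R_1,R_2)$, for two receivers with caches of $nM$ bits, consists of arbitrary maps as follows. An encoder maps $(X_1^n,X_2^n)$ to descriptions $(W_0,W_1,W_2)$, $W_j\in[1:2^{nR_j})$. Cache encoders map $(W_0,W_1,W_2)$ to $Z_i\in[1:2^{nM})$,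 $i=1,2$. For each demand $\mathbf d=(d_1,d_2)\in\{1,2\}^2$, a multicast encoder maps $(\mathbf d,Z_1,Z_2,W_0,W_1,W_2)$ to a binary string $Y_{\mathbf d}$ of variable length $L(Y_{\mathbf d})$. Receiver $i$ computes $(\widehat W_0,\widehat W_{d_i})$ from $(\mathbf d,Y_{\mathbf d},Z_i)$, and an estimate $\widehat X_{d_i}^n$ of its requested file from $(\widehat W_0,\widehat W_{d_i})$. A pair $(R,M)$ is achievable with description rates $(R_0,R_1,R_2)$ if there is a sequence of such schemes with strictly increasing block lengths $n$ such that 1. for the library drawn from the source, $\max_{\mathbf d}\max_i \mathbb P(\widehat X^n_{d_i}\ne X^n_{d_i})\to0$ and $\limsup \max_{\mathbf d}\frac1n\mathbb E[L(Y_{\mathbf d})]\le R$; 2. the caching and delivery step is correlation-unaware, i.e. it treats the descriptions as a library of independent files: also when $W_0,W_1,W_2$ are replaced by independent random variables uniform on $[1:2^{nR_0}),[1:2^{nR_1}),[1:2^{nR_2})$, one has $\max_{\mathbf d}\max_i\mathbb P\big((\widehat W_0,\widehat W_{d_i})\ne(W_0,W_{d_i})\big)\to0$ and $\limsup\max_{\mathbf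 d}\frac1n\mathbb E[L(Y_{\mathbf d})]\le R$. Let $\mathfrak R_{GW}(U)\subseteq\mathbb R^2$ be the closure of the set of pairs $(R,M)$ that are achievable with some description rates $(R_0,R_1,R_2)\in\mathcal R_{GW}(U)$, and let $R^*_{GW}(M,U)=\inf\{R:(R,M)\in\mathfrak R_{GW}(U)\}$ be the peak $U$-rate-memory function. Theorem. For every $p(x_1,x_2)$, every $p(u|x_1,x_2)$ and every $M\ge0$, one has $R^*_{GW}(M,U)\ge R^{LB}_{GW}(M,U)$, where $R^{LB}_{GW}(M,U)$ is the infimum of all $R\in\mathbb R$ such that $$R\ge I(X_1,X_2;U)+H(X_1|U)+H(X_2|U)-2M,$$ $$R\ge\tfrac12\big(I(X_1,X_2;U)+H(X_1|U)+H(X_2|U)-M\big),$$ $$R\ge I(X_1,X_2;U)+H(X_1|U)+\tfrac12H(X_2|U)-M,$$ $$R\ge I(X_1,X_2;U)+\tfrac12H(X_1|U)+H(X_2|U)-M.$$ -/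

import Mathlib

open Filter Topology

namespace GWCache

noncomputable section

/-! ### Finite probability and Shannon information measures (in bits) -/

/-- Expectation of a real function under a pmf on a finite type. -/
def expect {α : Type*} [Fintype α] (p : PMF α) (f : α → ℝ) : ℝ :=
  ∑ a, (p a).toReal * f a

/-- Probability of an event under a pmf on a finite type. -/
def prob {α : Type*} [Fintype α] (p : PMF α) (E : Set α) : ℝ :=
  expect p (E.indicator 1)

/-- Conditional entropy `H(A | B)` in bits, for `(A, B)` distributed as `q`. -/
def condEntropy {α β : Type*} [Fintype α] [Fintype β] (q : PMF (α × β)) : ℝ :=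
  -∑ a, ∑ b, (q (a, b)).toReal *
    Real.logb 2 ((q (a, b)).toReal / (q.map Prod.snd b).toReal)

/-- Mutual information `I(A ; B)` in bits, for `(A, B)` distributed as `q`. -/
def mutualInfo {α β : Type*} [Fintype α] [Fintype β] (q : PMF (α × β)) : ℝ :=
  ∑ a, ∑ b, (q (a, b)).toReal *
    Real.logb 2 ((q (a, b)).toReal /
      ((q.map Prod.fst a).toReal * (q.map Prod.snd b).toReal))

/-- The law of `n` i.i.d. symbols with pmf `p` (discrete memoryless source). -/
def iid {α : Type*} [Fintype α] (p : PMF α) (n : ℕ) : PMF (Fin n → α) :=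
  PMF.ofFintype (fun x => ∏ i, p (x i)) (by
    classical
    have h : ∑ a, p a = 1 := by rw [← tsum_fintype (L := .unconditional _)]; exact p.tsum_coe
    rw [← Fintype.prod_sum (fun (_ : Fin n) a => p a)]
    simp [h])

/-- The index set `[1 : 2^{nr})`, that is, the `2^⌊nr⌋` words of `⌊nr⌋` bits. -/
abbrev Index (n : ℕ) (r : ℝ) : Type := Fin (2 ^ ⌊(n : ℝ) * r⌋₊)

/-- A demand: receiver `i` requests file `d i`. There are two receivers and two files,
both indexed by `Fin 2`. -/
abbrev Demand : Type := Fin 2 → Fin 2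

/-- A triple of descriptions `(W₀, W₁, W₂)`, of rates `R₀` (common) and `ρ 0`, `ρ 1` (private). -/
abbrev Descriptions (n : ℕ) (R₀ : ℝ) (ρ : Fin 2 → ℝ) : Type :=
  Index n R₀ × (∀ j, Index n (ρ j))

section Source

variable {X : Fin 2 → Type*} [∀ j, Fintype (X j)] {U : Type*} [Fintype U]

/-- The joint law of `((X₁, X₂), U)` for a source pmf `p` and a conditional pmf `p(u | x₁, x₂)`. -/
def jointLaw (p : PMF (∀ j, X j)) (κ : (∀ j, X j) → PMF U) : PMF ((∀ j, X j) × U) :=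
  p.bind fun x => (κ x).map fun u => (x, u)

/-- `I(X₁, X₂ ; U)`. -/
def infoXU (p : PMF (∀ j, X j)) (κ : (∀ j, X j) → PMF U) : ℝ :=
  mutualInfo (jointLaw p κ)

/-- `H(X_j | U)`. -/
def entXgivenU (p : PMF (∀ j, X j)) (κ : (∀ j, X j) → PMF U) (j : Fin 2) : ℝ :=
  condEntropy ((jointLaw p κ).map fun a => (a.1 j, a.2))

/-- The set of Gray-Wyner rate triplets `(R₀, R₁, R₂)` for the auxiliary variable `U`. -/
def gwRegion (p : PMF (∀ j, X j)) (κ : (∀ j, X j) → PMF U) : Set (ℝ × (Fin 2 → ℝ)) :=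
  {r | infoXU p κ ≤ r.1 ∧ ∀ j, entXgivenU p κ j ≤ r.2 j}

end Source

/-- A Gray-Wyner cache-aided coded multicast scheme of block length `n`, description rates
`R₀, ρ 0, ρ 1` and (normalized) cache capacity `M`. The codeword is a bit string of variable
length. -/
structure Scheme (X : Fin 2 → Type*) (n : ℕ) (R₀ : ℝ) (ρ : Fin 2 → ℝ) (M : ℝ) where
  /-- Gray-Wyner encoder. -/
  gwEncoder : (∀ j, Fin n → X j) → Descriptions n R₀ ρ
  /-- Cache encoder of each receiver. -/
  cacheEncoder : Fin 2 → Descriptions n R₀ ρ → Index n M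
  /-- Multicast encoder. -/
  multicastEncoder : Demand → (Fin 2 → Index n M) → Descriptions n R₀ ρ → List Bool
  /-- Multicast decoder of each receiver: recovers the common description and the private
  description of the requested file. -/
  multicastDecoder : (i : Fin 2) → (d : Demand) → List Bool → Index n M →
    Index n R₀ × Index n (ρ (d i))
  /-- Gray-Wyner decoder of each receiver, for each file. -/
  gwDecoder : (i : Fin 2) → (j : Fin 2) → Index n R₀ × Index n (ρ j) → (Fin n → X j)

namespace Scheme

variable {X : Fin 2 → Type*} {n : ℕ} {R₀ : ℝ} {ρ : Fin 2 → ℝ} {M : ℝ}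

/-- The cache content of receiver `i`. -/
def cache (S : Scheme X n R₀ ρ M) (w : Descriptions n R₀ ρ) (i : Fin 2) : Index n M :=
  S.cacheEncoder i w

/-- The multicast codeword for demand `d`. -/
def codeword (S : Scheme X n R₀ ρ M) (d : Demand) (w : Descriptions n R₀ ρ) : List Bool :=
  S.multicastEncoder d (S.cache w) w

/-- The pair of descriptions decoded by receiver `i`. -/
def decodedDescr (S : Scheme X n R₀ ρ M) (d : Demand) (i : Fin 2) (w : Descriptions n R₀ ρ) :
    Index n R₀ × Index n (ρ (d i)) :=
  S.multicastDecoder i d (S.codeword d w) (S.cache w i)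

/-- The descriptions of a library realization, given symbol by symbol. -/
def describe (S : Scheme X n R₀ ρ M) (x : Fin n → ∀ j, X j) : Descriptions n R₀ ρ :=
  S.gwEncoder fun j t => x t j

/-- The reconstruction by receiver `i` of its requested file. -/
def decodedFile (S : Scheme X n R₀ ρ M) (d : Demand) (i : Fin 2) (x : Fin n → ∀ j, X j) :
    Fin n → X (d i) :=
  S.gwDecoder i (d i) (S.decodedDescr d i (S.describe x))

/-- The worst-case probability of error: the largest probability, over demands and receivers, that
the requested file is not recovered, when the library is drawn from the memoryless source. -/
def errorProb [∀ j, Fintype (X j)] (S : Scheme X n R₀ ρ M) (p : PMF (∀ j, X j)) : ℝ :=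
  ⨆ d : Demand, ⨆ i : Fin 2,
    prob (iid p n) {x | S.decodedFile d i x ≠ fun t => x t (d i)}

/-- The worst-case probability that a receiver does not recover its descriptions, when the triple
of descriptions has law `q`. -/
def descrErrorProb (S : Scheme X n R₀ ρ M) (q : PMF (Descriptions n R₀ ρ)) : ℝ :=
  ⨆ d : Demand, ⨆ i : Fin 2,
    prob q {w | S.decodedDescr d i w ≠ (w.1, w.2 (d i))}

/-- The peak multicast rate when the triple of descriptions has law `q`: the largest expected
codeword length in bits, over demands, divided by the block length. -/
def peakRate (S : Scheme X n R₀ ρ M) (q : PMF (Descriptions n R₀ ρ)) : ℝ :=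
  ⨆ d : Demand, expect q (fun w => ((S.codeword d w).length : ℝ)) / n

/-- The law of the descriptions of a library drawn from the memoryless source. -/
def sourceLaw [∀ j, Fintype (X j)] (S : Scheme X n R₀ ρ M) (p : PMF (∀ j, X j)) :
    PMF (Descriptions n R₀ ρ) :=
  (iid p n).map S.describe

end Scheme

/-- The law under which the three descriptions are independent files, uniformly distributed
on their index sets. -/
def independentLaw (n : ℕ) (R₀ : ℝ) (ρ : Fin 2 → ℝ) : PMF (Descriptions n R₀ ρ) :=
  PMF.uniformOfFintype _

/-- The rate-memory pair `(R, M)` is achieved by Gray-Wyner schemes with description rates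
`R₀, ρ 0, ρ 1`: along schemes of increasing block length the files of the source are recovered with
vanishing error probability, the peak rate is asymptotically at most `R`, and the caching and
delivery step is correlation-unaware: it treats the descriptions as a library of independent
files, so that it recovers them with vanishing error probability at asymptotic peak rate at
most `R` also when they are independent and uniform. -/
def AchievableWith {X : Fin 2 → Type*} [∀ j, Fintype (X j)] (p : PMF (∀ j, X j))
    (R₀ : ℝ) (ρ : Fin 2 → ℝ) (R M : ℝ) : Prop :=
  0 ≤ M ∧ ∃ (n : ℕ → ℕ) (S : ∀ k, Scheme X (n k) R₀ ρ M), StrictMono n ∧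
    Tendsto (fun k => (S k).errorProb p) atTop (𝓝 0) ∧
    limsup (fun k => (((S k).peakRate ((S k).sourceLaw p) : ℝ) : EReal)) atTop ≤ (R : EReal) ∧
    Tendsto (fun k => (S k).descrErrorProb (independentLaw (n k) R₀ ρ)) atTop (𝓝 0) ∧
    limsup (fun k => (((S k).peakRate (independentLaw (n k) R₀ ρ) : ℝ) : EReal)) atTop
      ≤ (R : EReal)

section Bounds

variable {X : Fin 2 → Type*} [∀ j, Fintype (X j)] {U : Type*} [Fintype U]

/-- The peak `U`-rate-memory region of the class of Gray-Wyner schemes. -/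
def rateMemoryRegion (p : PMF (∀ j, X j)) (κ : (∀ j, X j) → PMF U) : Set (ℝ × ℝ) :=
  closure {a | ∃ r ∈ gwRegion p κ, AchievableWith p r.1 r.2 a.1 a.2}

/-- The peak `U`-rate-memory function `inf {R : (R, M) ∈ region}`, as an extended real. -/
def rateMemoryFunction (p : PMF (∀ j, X j)) (κ : (∀ j, X j) → PMF U) (M : ℝ) : EReal :=
  sInf ((fun R : ℝ => (R : EReal)) '' {R | (R, M) ∈ rateMemoryRegion p κ})

/-- The lower bound: the smallest `R` that satisfies the four linear inequalities. -/
def lowerBound (p : PMF (∀ j, X j)) (κ : (∀ j, X j) → PMF U) (M : ℝ) : ℝ :=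
  sInf {R : ℝ |
    infoXU p κ + entXgivenU p κ 0 + entXgivenU p κ 1 - 2 * M ≤ R ∧
    1 / 2 * (infoXU p κ + entXgivenU p κ 0 + entXgivenU p κ 1 - M) ≤ R ∧
    infoXU p κ + entXgivenU p κ 0 + 1 / 2 * entXgivenU p κ 1 - M ≤ R ∧
    infoXU p κ + 1 / 2 * entXgivenU p κ 0 + entXgivenU p κ 1 - M ≤ R}

end Bounds

end

end GWCache

namespace GWCache

/-! ### Subprobability weights and Gibbs' inequality -/

/-! The bound is a cut-set converse, and only the correlation-unaware requirement is needed: for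
independent uniform descriptions the caching and delivery step is an ordinary caching code. The
source enters only at the end, through the lower bounds on the description rates.

Entropy is replaced by ideal code lengths. A subprobability weight `q` assigns the cost `-log q`,
and Gibbs' inequality (`IsSubprob.card_mul_log_card_le`) says that the average cost of an injective
description of a uniform variable is at least the logarithm of its cardinality. Submodularity of
entropy becomes `IsSubprob.two_mul_log_card_add_le`. Decoding errors are removed by sending the
descriptions in the clear whenever a receiver fails; `Scheme.sum_neg_log_weight_le` bounds the
resulting cost in the manner of Fano's inequality.

Three cuts remain. One codeword with both caches determines everything, and so do two codewords with
one cache. Finally, two pairs (codeword, cache) each determine the common description and the same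
private one, and jointly determine the other private one, so submodularity applies. Normalizing by
the block length gives `AchievableWith.rate_bounds`. These bounds are linear and increasing in the
description rates, and the inequalities that follow are closed conditions on the pair of rate and
memory, so they pass to the closure. -/

/-- A positive weight all of whose finite sums are at most one. -/
structure IsSubprob {α : Type*} (q : α → ℝ) : Prop where
  pos : ∀ a, 0 < q a
  sum_le : ∀ T : Finset α, ∑ a ∈ T, q a ≤ 1

namespace IsSubprob

variable {α β : Type*}

theorem prod {p : α → ℝ} {q : β → ℝ} (hp : IsSubprob p) (hq : IsSubprob q) :
    IsSubprob fun x : α × β => p x.1 * q x.2 := by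
  classical
  refine ⟨fun x => mul_pos (hp.pos _) (hq.pos _), fun T => ?_⟩
  calc ∑ x ∈ T, p x.1 * q x.2
      ≤ ∑ x ∈ T.image Prod.fst ×ˢ T.image Prod.snd, p x.1 * q x.2 :=
        Finset.sum_le_sum_of_subset_of_nonneg Finset.subset_product
          fun x _ _ => (mul_pos (hp.pos _) (hq.pos _)).le
    _ = (∑ a ∈ T.image Prod.fst, p a) * ∑ b ∈ T.image Prod.snd, q b := by
        rw [Finset.sum_product, Finset.sum_mul_sum]
    _ ≤ 1 := mul_le_one₀ (hp.sum_le _) (Finset.sum_nonneg fun b _ => (hq.pos b).le) (hq.sum_le _)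

theorem uniform (α : Type*) [Fintype α] [Nonempty α] :
    IsSubprob fun _ : α => ((Fintype.card α : ℝ))⁻¹ := by
  have hc : (0 : ℝ) < Fintype.card α := by exact_mod_cast Fintype.card_pos
  refine ⟨fun _ => inv_pos.2 hc, fun T => ?_⟩
  rw [Finset.sum_const, nsmul_eq_mul, ← div_eq_mul_inv, div_le_one hc]
  exact_mod_cast Finset.card_le_univ T

/-- Mixing two weights with equal probabilities. -/
theorem half_sum {p : α → ℝ} {q : β → ℝ} (hp : IsSubprob p) (hq : IsSubprob q) :
    IsSubprob (Sum.elim (fun a => p a / 2) fun b => q b / 2) := by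
  refine ⟨?_, fun T => ?_⟩
  · rintro (a | b)
    · exact half_pos (hp.pos a)
    · exact half_pos (hq.pos b)
  · rw [← Finset.toLeft_disjSum_toRight (u := T), Finset.sum_disjSum]
    simp only [Sum.elim_inl, Sum.elim_inr, ← Finset.sum_div]
    linarith [hp.sum_le T.toLeft, hq.sum_le T.toRight]

theorem comp_injective {q : β → ℝ} (hq : IsSubprob q) {f : α → β} (hf : f.Injective) :
    IsSubprob (q ∘ f) :=
  ⟨fun _ => hq.pos _, fun T => by
    have := hq.sum_le (T.map ⟨f, hf⟩)
    rwa [Finset.sum_map] at this⟩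

/-- **Gibbs' inequality** against the uniform distribution. -/
theorem card_mul_log_card_le [Fintype α] [Nonempty α] {q : α → ℝ} (hq : IsSubprob q) :
    Fintype.card α * Real.log (Fintype.card α) ≤ ∑ a, -Real.log (q a) := by
  have hc : (0 : ℝ) < Fintype.card α := by exact_mod_cast Fintype.card_pos
  have h : ∑ a, (Real.log (Fintype.card α) + Real.log (q a)) ≤
      ∑ a, ((Fintype.card α : ℝ) * q a - 1) := Finset.sum_le_sum fun a _ => by
    rw [← Real.log_mul hc.ne' (hq.pos a).ne']
    exact Real.log_le_sub_one_of_pos (mul_pos hc (hq.pos a))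
  rw [Finset.sum_add_distrib, Finset.sum_sub_distrib, ← Finset.mul_sum] at h
  simp only [Finset.sum_const, Finset.card_univ, nsmul_eq_mul, mul_one] at h
  rw [Finset.sum_neg_distrib]
  nlinarith [hq.sum_le Finset.univ]

/-- The total weight of the images of the fibers of the first coordinate, when these images are
disjoint. -/
theorem sum_image_fiber {W V : Type*} [Fintype V] [Nonempty V] [DecidableEq α] {q : α → ℝ}
    (hq : IsSubprob q) {f : W × V → α} (hf : ∀ x y, f x = f y → x.1 = y.1) :
    IsSubprob fun w => ∑ a ∈ Finset.univ.image fun v => f (w, v), q a := by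
  classical
  refine ⟨fun w => Finset.sum_pos (fun a _ => hq.pos a) (Finset.univ_nonempty.image _),
    fun T => ?_⟩
  rw [← Finset.sum_biUnion]
  · exact hq.sum_le _
  · intro w _ w' _ hne
    refine Finset.disjoint_left.2 fun a ha ha' => hne ?_
    obtain ⟨v, -, rfl⟩ := Finset.mem_image.1 ha
    obtain ⟨v', -, hv⟩ := Finset.mem_image.1 ha'
    exact (hf _ _ hv).symm

/-- If `f` and `g` both determine the first coordinate of a pair, and jointly determine the pair,
then the two descriptions cost together at least twice the first coordinate plus the second. This
is the counterpart for code lengths of the submodularity of entropy. -/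
theorem two_mul_log_card_add_le {W V : Type*} [Fintype W] [Nonempty W] [Fintype V] [Nonempty V]
    {p : α → ℝ} {q : β → ℝ} (hp : IsSubprob p) (hq : IsSubprob q)
    {f : W × V → α} {g : W × V → β} (hf : ∀ x y, f x = f y → x.1 = y.1)
    (hg : ∀ x y, g x = g y → x.1 = y.1) (hfg : ∀ x y, f x = f y → g x = g y → x = y) :
    Fintype.card (W × V) * (2 * Real.log (Fintype.card W) + Real.log (Fintype.card V)) ≤
      ∑ x, (-Real.log (p (f x)) + -Real.log (q (g x))) := by
  classical
  have ha := hp.sum_image_fiber hf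
  have hb := hq.sum_image_fiber hg
  set a : W → ℝ := fun w => ∑ x ∈ Finset.univ.image fun v => f (w, v), p x
  set b : W → ℝ := fun w => ∑ x ∈ Finset.univ.image fun v => g (w, v), q x
  -- This is the conditional weight of `v` given `w`. The values `(f (w, v), g (w, v))` are distinct
  -- for distinct `v` and lie in a product of two images whose total weight is `a w * b w`. Gibbs on
  -- each fiber gives `log |V|`; Gibbs for `a` and for `b` gives `log |W|` twice.
  have hr : ∀ w, IsSubprob fun v => p (f (w, v)) * q (g (w, v)) / (a w * b w) := by
    intro w
    have hab := mul_pos (ha.pos w) (hb.pos w)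
    refine ⟨fun v => div_pos (mul_pos (hp.pos _) (hq.pos _)) hab, fun T => ?_⟩
    rw [← Finset.sum_div, div_le_one hab, Finset.sum_mul_sum, ← Finset.sum_product']
    have hinj : Function.Injective fun v => (f (w, v), g (w, v)) := fun v v' h =>
      (Prod.ext_iff.1 (hfg _ _ (Prod.ext_iff.1 h).1 (Prod.ext_iff.1 h).2)).2
    calc ∑ v ∈ T, p (f (w, v)) * q (g (w, v))
        = ∑ x ∈ T.map ⟨_, hinj⟩, p x.1 * q x.2 := by rw [Finset.sum_map]; rfl
      _ ≤ _ := by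
        refine Finset.sum_le_sum_of_subset_of_nonneg (fun x hx => ?_)
          fun x _ _ => (mul_pos (hp.pos _) (hq.pos _)).le
        obtain ⟨v, -, rfl⟩ := Finset.mem_map.1 hx
        exact Finset.mem_product.2 ⟨Finset.mem_image_of_mem _ (Finset.mem_univ v),
          Finset.mem_image_of_mem _ (Finset.mem_univ v)⟩
  have hfib : ∀ w, Fintype.card V *
      (Real.log (Fintype.card V) + -Real.log (a w) + -Real.log (b w)) ≤
      ∑ v, (-Real.log (p (f (w, v))) + -Real.log (q (g (w, v)))) := by
    intro w
    have h := (hr w).card_mul_log_card_le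
    have e : ∀ v, -Real.log (p (f (w, v)) * q (g (w, v)) / (a w * b w)) =
        (-Real.log (p (f (w, v))) + -Real.log (q (g (w, v)))) +
          (Real.log (a w) + Real.log (b w)) := by
      intro v
      rw [Real.log_div (mul_pos (hp.pos _) (hq.pos _)).ne' (mul_pos (ha.pos w) (hb.pos w)).ne',
        Real.log_mul (hp.pos _).ne' (hq.pos _).ne', Real.log_mul (ha.pos w).ne' (hb.pos w).ne']
      ring
    rw [Finset.sum_congr rfl fun v _ => e v, Finset.sum_add_distrib (g := fun _ => _),
      Finset.sum_const, Finset.card_univ, nsmul_eq_mul] at h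
    linarith
  have hsum := Finset.sum_le_sum fun w (_ : w ∈ Finset.univ) => hfib w
  rw [← Finset.mul_sum, Finset.sum_add_distrib, Finset.sum_add_distrib, Finset.sum_const,
    Finset.card_univ, nsmul_eq_mul, ← Fintype.sum_prod_type'
      (f := fun w v => -Real.log (p (f (w, v))) + -Real.log (q (g (w, v))))] at hsum
  refine le_trans ?_ hsum
  have h := add_le_add ha.card_mul_log_card_le hb.card_mul_log_card_le
  have hV : (0 : ℝ) ≤ Fintype.card V := Nat.cast_nonneg _
  rw [Fintype.card_prod, Nat.cast_mul]
  linarith [mul_le_mul_of_nonneg_left h hV]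

end IsSubprob

/-! ### A weight on bit strings -/

theorem card_filter_length_le (T : Finset (List Bool)) (l : ℕ) :
    (T.filter fun y => y.length = l).card ≤ 2 ^ l := by
  calc (T.filter fun y => y.length = l).card
      ≤ (Finset.univ : Finset (List.Vector Bool l)).card :=
        Finset.card_le_card_of_surjOn Subtype.val fun y hy =>
          ⟨⟨y, (Finset.mem_filter.1 hy).2⟩, Finset.mem_coe.2 (Finset.mem_univ _), rfl⟩
    _ = 2 ^ l := by rw [Finset.card_univ, card_vector, Fintype.card_bool]

/-- A weight on bit strings that decays slightly faster than `2 ^ (-length)`. -/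
noncomputable def stringWeight (s : ℝ) (y : List Bool) : ℝ :=
  (1 - 2 * Real.exp (-s)) * Real.exp (-s) ^ y.length

theorem two_mul_exp_neg_lt_one {s : ℝ} (hs : Real.log 2 < s) : 2 * Real.exp (-s) < 1 := by
  have h : Real.exp (-s) < Real.exp (-Real.log 2) := Real.exp_lt_exp.2 (neg_lt_neg hs)
  rw [Real.exp_neg (Real.log 2), Real.exp_log two_pos] at h
  linarith

/-- There are `2 ^ l` strings of length `l`, so grouping by length leaves a geometric series of
ratio `2 * exp (-s)`. The codewords need not be prefix-free, so the weight `2 ^ (-length)` would not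
be summable; this is why `s` must exceed `log 2` strictly. -/
theorem isSubprob_stringWeight {s : ℝ} (hs : Real.log 2 < s) : IsSubprob (stringWeight s) := by
  have h1 := two_mul_exp_neg_lt_one hs
  have h0 := Real.exp_pos (-s)
  refine ⟨fun y => mul_pos (by linarith) (pow_pos h0 _), fun T => ?_⟩
  have hm : ∀ y ∈ T, y.length ∈ Finset.range (T.sup List.length + 1) := fun y hy =>
    Finset.mem_range.2 (Nat.lt_succ_of_le (Finset.le_sup (f := List.length) hy))
  simp only [stringWeight]
  rw [← Finset.mul_sum, ← Finset.sum_fiberwise_of_maps_to hm]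
  calc (1 - 2 * Real.exp (-s)) * ∑ l ∈ Finset.range (T.sup List.length + 1),
        ∑ y ∈ T with y.length = l, Real.exp (-s) ^ y.length
      ≤ (1 - 2 * Real.exp (-s)) * ∑ l ∈ Finset.range (T.sup List.length + 1),
        (2 * Real.exp (-s)) ^ l := by
        refine mul_le_mul_of_nonneg_left (Finset.sum_le_sum fun l _ => ?_) (by linarith)
        rw [Finset.sum_congr rfl fun y hy => by rw [(Finset.mem_filter.1 hy).2],
          Finset.sum_const, nsmul_eq_mul, mul_pow]
        exact mul_le_mul_of_nonneg_right (by exact_mod_cast card_filter_length_le T l)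
          (pow_pos h0 _).le
    _ = 1 - (2 * Real.exp (-s)) ^ (T.sup List.length + 1) := mul_neg_geom_sum _ _
    _ ≤ 1 := by linarith [pow_pos (mul_pos two_pos h0) (T.sup List.length + 1)]

theorem neg_log_stringWeight {s : ℝ} (hs : Real.log 2 < s) (y : List Bool) :
    -Real.log (stringWeight s y) = s * y.length - Real.log (1 - 2 * Real.exp (-s)) := by
  have h1 := two_mul_exp_neg_lt_one hs
  rw [stringWeight, Real.log_mul (by linarith) (pow_pos (Real.exp_pos _) _).ne', Real.log_pow,
    Real.log_exp]
  ring

end GWCache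

namespace GWCache

/-! ### Schemes with errors removed -/

theorem card_mul_expect_independentLaw (n : ℕ) (R₀ : ℝ) (ρ : Fin 2 → ℝ)
    (f : Descriptions n R₀ ρ → ℝ) :
    Fintype.card (Descriptions n R₀ ρ) * expect (independentLaw n R₀ ρ) f = ∑ w, f w := by
  have hc : (Fintype.card (Descriptions n R₀ ρ) : ℝ) ≠ 0 := by
    exact_mod_cast Fintype.card_ne_zero
  simp only [expect, independentLaw, PMF.uniformOfFintype_apply, ENNReal.toReal_inv,
    ENNReal.toReal_natCast]
  rw [← Finset.mul_sum, ← mul_assoc, mul_inv_cancel₀ hc, one_mul]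

theorem log_card_index (n : ℕ) (r : ℝ) :
    Real.log (Fintype.card (Index n r)) = ⌊(n : ℝ) * r⌋₊ * Real.log 2 := by
  rw [Fintype.card_fin, Nat.cast_pow, Nat.cast_ofNat, Real.log_pow]

theorem log_card_descriptions (n : ℕ) (R₀ : ℝ) (ρ : Fin 2 → ℝ) :
    Real.log (Fintype.card (Descriptions n R₀ ρ)) =
      (⌊(n : ℝ) * R₀⌋₊ + ⌊(n : ℝ) * ρ 0⌋₊ + ⌊(n : ℝ) * ρ 1⌋₊) * Real.log 2 := by
  simp only [Fintype.card_prod, Fintype.card_pi, Fin.prod_univ_two, Fintype.card_fin]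
  push_cast
  rw [← pow_add, ← pow_add, Real.log_pow]
  push_cast
  ring

theorem prob_le_sum {α ι : Type*} [Fintype α] [Fintype ι] (p : PMF α) (E : ι → Set α) :
    prob p {a | ∃ i, a ∈ E i} ≤ ∑ i, prob p (E i) := by
  classical
  simp only [prob, expect]
  rw [Finset.sum_comm]
  refine Finset.sum_le_sum fun a _ => ?_
  rw [← Finset.mul_sum]
  refine mul_le_mul_of_nonneg_left ?_ ENNReal.toReal_nonneg
  have h0 : ∀ i, (0 : ℝ) ≤ (E i).indicator 1 a := fun i =>
    Set.indicator_nonneg (fun _ _ => zero_le_one) _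
  by_cases h : ∃ i, a ∈ E i
  · obtain ⟨i, hi⟩ := h
    rw [Set.indicator_of_mem (show a ∈ {a | ∃ i, a ∈ E i} from ⟨i, hi⟩)]
    refine le_trans (le_of_eq ?_) (Finset.single_le_sum (fun i _ => h0 i) (Finset.mem_univ i))
    rw [Set.indicator_of_mem hi]
  · rw [Set.indicator_of_notMem (show a ∉ {a | ∃ i, a ∈ E i} from h)]
    exact Finset.sum_nonneg fun i _ => h0 i

namespace Scheme

variable {X : Fin 2 → Type*} {n : ℕ} {R₀ : ℝ} {ρ : Fin 2 → ℝ} {M : ℝ}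

open Classical in
/-- The multicast codeword if both receivers decode it correctly, and otherwise the descriptions
themselves. -/
noncomputable def correctedCodeword (S : Scheme X n R₀ ρ M) (d : Demand)
    (w : Descriptions n R₀ ρ) : List Bool ⊕ Descriptions n R₀ ρ :=
  if ∃ i, S.decodedDescr d i w ≠ (w.1, w.2 (d i)) then Sum.inr w else Sum.inl (S.codeword d w)

/-- The two summands tell failure from success. On failure the value is the description triple
itself; on success decoding is exact, and the decoder sees only the codeword and the cache. -/
theorem eq_of_correctedCodeword_eq (S : Scheme X n R₀ ρ M) (d : Demand) (i : Fin 2)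
    {w w' : Descriptions n R₀ ρ} (hY : S.correctedCodeword d w = S.correctedCodeword d w')
    (hZ : S.cache w i = S.cache w' i) : w.1 = w'.1 ∧ w.2 (d i) = w'.2 (d i) := by
  unfold correctedCodeword at hY
  split_ifs at hY with h h' h'
  · rw [Sum.inr.inj hY]
    exact ⟨rfl, rfl⟩
  · push Not at h h'
    have e : S.decodedDescr d i w = S.decodedDescr d i w' := by
      rw [decodedDescr, decodedDescr, Sum.inl.inj hY, hZ]
    rw [h i, h' i] at e
    exact Prod.ext_iff.1 e

/-- A weight on the corrected codewords. -/
noncomputable def weight (n : ℕ) (R₀ : ℝ) (ρ : Fin 2 → ℝ) (s : ℝ) :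
    List Bool ⊕ Descriptions n R₀ ρ → ℝ :=
  Sum.elim (fun y => stringWeight s y / 2)
    fun _ => ((Fintype.card (Descriptions n R₀ ρ) : ℝ))⁻¹ / 2

theorem isSubprob_weight {s : ℝ} (hs : Real.log 2 < s) : IsSubprob (weight n R₀ ρ s) :=
  (isSubprob_stringWeight hs).half_sum (IsSubprob.uniform _)

/-- An upper bound on the expected logarithmic cost of the corrected codewords. -/
noncomputable def costBound (S : Scheme X n R₀ ρ M) (s : ℝ) : ℝ :=
  Real.log 2 - Real.log (1 - 2 * Real.exp (-s)) +
    s * (n * S.peakRate (independentLaw n R₀ ρ)) +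
    2 * S.descrErrorProb (independentLaw n R₀ ρ) *
      Real.log (Fintype.card (Descriptions n R₀ ρ))

/-- A correct codeword costs `s` per bit and an error costs `log N`, where `N` counts the
description triples, up to a constant that covers both cases because `log (1 - 2 * exp (-s))` is
nonpositive. Averaging yields the peak rate and the error probability. -/
theorem sum_neg_log_weight_le (S : Scheme X n R₀ ρ M) (hn : 0 < n) {s : ℝ}
    (hs : Real.log 2 < s) (d : Demand) :
    ∑ w, -Real.log (weight n R₀ ρ s (S.correctedCodeword d w)) ≤
      Fintype.card (Descriptions n R₀ ρ) * S.costBound s := by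
  classical
  set N : ℝ := (Fintype.card (Descriptions n R₀ ρ) : ℝ) with hN
  have hN1 : 1 ≤ N := by rw [hN]; exact_mod_cast Fintype.card_pos
  have hN0 : 0 < N := by linarith
  have hl : 0 ≤ Real.log N := Real.log_nonneg hN1
  have hs0 : 0 < s := (Real.log_pos one_lt_two).trans hs
  set E : Set (Descriptions n R₀ ρ) := {w | ∃ i, S.decodedDescr d i w ≠ (w.1, w.2 (d i))} with hE
  have h1 := two_mul_exp_neg_lt_one hs
  have hC : Real.log (1 - 2 * Real.exp (-s)) ≤ 0 :=
    Real.log_nonpos (by linarith) (by linarith [Real.exp_pos (-s)])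
  have hpt : ∀ w, -Real.log (weight n R₀ ρ s (S.correctedCodeword d w)) ≤
      (Real.log 2 - Real.log (1 - 2 * Real.exp (-s))) + s * (S.codeword d w).length +
        E.indicator 1 w * Real.log N := by
    intro w
    have hlen : 0 ≤ s * (S.codeword d w).length := by positivity
    by_cases h : w ∈ E
    · rw [show S.correctedCodeword d w = Sum.inr w from if_pos h, Set.indicator_of_mem h]
      simp only [weight, Sum.elim_inr, Pi.one_apply, one_mul]
      rw [Real.log_div (inv_ne_zero hN0.ne') two_ne_zero, Real.log_inv]
      linarith
    · rw [show S.correctedCodeword d w = Sum.inl (S.codeword d w) from if_neg h,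
        Set.indicator_of_notMem h]
      simp only [weight, Sum.elim_inl]
      rw [Real.log_div ((isSubprob_stringWeight hs).pos _).ne' two_ne_zero]
      linarith [neg_log_stringWeight hs (S.codeword d w)]
  have hrate : expect (independentLaw n R₀ ρ) (fun w => ((S.codeword d w).length : ℝ)) ≤
      n * S.peakRate (independentLaw n R₀ ρ) := by
    rw [← div_le_iff₀' (by exact_mod_cast hn)]
    exact le_ciSup (f := fun d : Demand => expect (independentLaw n R₀ ρ)
      (fun w => ((S.codeword d w).length : ℝ)) / n) (Set.finite_range _).bddAbove d
  -- Union bound over the two receivers, the source of the factor 2 in `costBound`.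
  have herr : prob (independentLaw n R₀ ρ) E ≤
      2 * S.descrErrorProb (independentLaw n R₀ ρ) := by
    refine (prob_le_sum (independentLaw n R₀ ρ)
      fun i => {w | S.decodedDescr d i w ≠ (w.1, w.2 (d i))}).trans ?_
    have hi : ∀ i : Fin 2, prob (independentLaw n R₀ ρ)
        {w | S.decodedDescr d i w ≠ (w.1, w.2 (d i))} ≤
        S.descrErrorProb (independentLaw n R₀ ρ) := fun i =>
      (le_ciSup (f := fun i : Fin 2 => prob (independentLaw n R₀ ρ)
        {w | S.decodedDescr d i w ≠ (w.1, w.2 (d i))}) (Set.finite_range _).bddAbove i).trans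
      (le_ciSup (f := fun d : Demand => ⨆ i : Fin 2, prob (independentLaw n R₀ ρ)
        {w | S.decodedDescr d i w ≠ (w.1, w.2 (d i))}) (Set.finite_range _).bddAbove d)
    rw [Fin.sum_univ_two]
    linarith [hi 0, hi 1]
  refine (Finset.sum_le_sum fun w _ => hpt w).trans ?_
  rw [Finset.sum_add_distrib, Finset.sum_add_distrib, Finset.sum_const, Finset.card_univ,
    nsmul_eq_mul, ← Finset.mul_sum, ← Finset.sum_mul,
    ← card_mul_expect_independentLaw n R₀ ρ (fun w => ((S.codeword d w).length : ℝ)),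
    ← card_mul_expect_independentLaw n R₀ ρ (E.indicator 1), ← hN]
  have a1 := mul_le_mul_of_nonneg_left (mul_le_mul_of_nonneg_left hrate hs0.le) hN0.le
  have a2 := mul_le_mul_of_nonneg_left (mul_le_mul_of_nonneg_right herr hl) hN0.le
  rw [prob] at a2
  rw [costBound, ← hN]
  linarith

/-! ### One-shot cut-set bounds -/

instance : Nonempty (Index n M) := ⟨⟨0, by positivity⟩⟩

/-- Under the demand `id` the receivers request different files, so one codeword and both caches
determine all descriptions. -/
theorem log_card_le_costBound_add_two_caches (S : Scheme X n R₀ ρ M) (hn : 0 < n) {s : ℝ}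
    (hs : Real.log 2 < s) :
    Real.log (Fintype.card (Descriptions n R₀ ρ)) ≤
      S.costBound s + 2 * Real.log (Fintype.card (Index n M)) := by
  have hinj : Function.Injective fun w => (S.correctedCodeword id w, S.cache w 0, S.cache w 1) := by
    intro w w' h
    simp only [Prod.mk.injEq] at h
    have h0 := S.eq_of_correctedCodeword_eq id 0 h.1 h.2.1
    have h1 := S.eq_of_correctedCodeword_eq id 1 h.1 h.2.2
    exact Prod.ext h0.1 (funext (Fin.forall_fin_two.2 ⟨h0.2, h1.2⟩))
  have hQ := (isSubprob_weight (n := n) (R₀ := R₀) (ρ := ρ) hs).prod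
    ((IsSubprob.uniform (Index n M)).prod (IsSubprob.uniform (Index n M)))
  have h := (hQ.comp_injective hinj).card_mul_log_card_le
  have hK : (Fintype.card (Index n M) : ℝ) ≠ 0 := by exact_mod_cast Fintype.card_ne_zero
  have e : ∀ w, -Real.log (weight n R₀ ρ s (S.correctedCodeword id w) *
      ((Fintype.card (Index n M) : ℝ)⁻¹ * (Fintype.card (Index n M) : ℝ)⁻¹)) =
      -Real.log (weight n R₀ ρ s (S.correctedCodeword id w)) +
        2 * Real.log (Fintype.card (Index n M)) := by
    intro w
    rw [Real.log_mul ((isSubprob_weight hs).pos _).ne' (by positivity),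
      Real.log_mul (by positivity) (by positivity), Real.log_inv]
    ring
  simp only [Function.comp_apply] at h
  rw [Finset.sum_congr rfl fun w _ => e w, Finset.sum_add_distrib, Finset.sum_const,
    Finset.card_univ, nsmul_eq_mul] at h
  refine le_of_mul_le_mul_left ?_
    (show (0 : ℝ) < Fintype.card (Descriptions n R₀ ρ) by exact_mod_cast Fintype.card_pos)
  linarith [S.sum_neg_log_weight_le hn hs id]

/-- Receiver 0 requests each file in turn, using its cache twice with two codewords. -/
theorem log_card_le_two_costBound_add_cache (S : Scheme X n R₀ ρ M) (hn : 0 < n) {s : ℝ}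
    (hs : Real.log 2 < s) :
    Real.log (Fintype.card (Descriptions n R₀ ρ)) ≤
      2 * S.costBound s + Real.log (Fintype.card (Index n M)) := by
  have hinj : Function.Injective fun w =>
      (S.correctedCodeword (fun _ => 0) w, S.correctedCodeword (fun _ => 1) w, S.cache w 0) := by
    intro w w' h
    simp only [Prod.mk.injEq] at h
    have h0 := S.eq_of_correctedCodeword_eq (fun _ => 0) 0 h.1 h.2.2
    have h1 := S.eq_of_correctedCodeword_eq (fun _ => 1) 0 h.2.1 h.2.2
    exact Prod.ext h0.1 (funext (Fin.forall_fin_two.2 ⟨h0.2, h1.2⟩))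
  have hw := isSubprob_weight (n := n) (R₀ := R₀) (ρ := ρ) hs
  have hQ := hw.prod (hw.prod (IsSubprob.uniform (Index n M)))
  have h := (hQ.comp_injective hinj).card_mul_log_card_le
  have hK : (Fintype.card (Index n M) : ℝ) ≠ 0 := by exact_mod_cast Fintype.card_ne_zero
  have e : ∀ w, -Real.log (weight n R₀ ρ s (S.correctedCodeword (fun _ => 0) w) *
      (weight n R₀ ρ s (S.correctedCodeword (fun _ => 1) w) *
        (Fintype.card (Index n M) : ℝ)⁻¹)) =
      -Real.log (weight n R₀ ρ s (S.correctedCodeword (fun _ => 0) w)) +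
        -Real.log (weight n R₀ ρ s (S.correctedCodeword (fun _ => 1) w)) +
        Real.log (Fintype.card (Index n M)) := by
    intro w
    rw [Real.log_mul (hw.pos _).ne' (mul_ne_zero (hw.pos _).ne' (by positivity)),
      Real.log_mul (hw.pos _).ne' (by positivity), Real.log_inv]
    ring
  simp only [Function.comp_apply] at h
  rw [Finset.sum_congr rfl fun w _ => e w, Finset.sum_add_distrib, Finset.sum_add_distrib,
    Finset.sum_const, Finset.card_univ, nsmul_eq_mul] at h
  refine le_of_mul_le_mul_left ?_
    (show (0 : ℝ) < Fintype.card (Descriptions n R₀ ρ) by exact_mod_cast Fintype.card_pos)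
  linarith [S.sum_neg_log_weight_le hn hs fun _ => 0, S.sum_neg_log_weight_le hn hs fun _ => 1]

/-- The descriptions, with the common one grouped with private description `j`. -/
def groupEquiv (n : ℕ) (R₀ : ℝ) (ρ : Fin 2 → ℝ) (j : Fin 2) :
    Descriptions n R₀ ρ ≃ (Index n R₀ × Index n (ρ j)) × Index n (ρ (j + 1)) :=
  match j with
  | 0 => ((Equiv.refl _).prodCongr (piFinTwoEquiv _)).trans (Equiv.prodAssoc _ _ _).symm
  | 1 => ((Equiv.refl _).prodCongr ((piFinTwoEquiv _).trans (Equiv.prodComm _ _))).trans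
      (Equiv.prodAssoc _ _ _).symm

theorem groupEquiv_apply_fst (j : Fin 2) (w : Descriptions n R₀ ρ) :
    (groupEquiv n R₀ ρ j w).1 = (w.1, w.2 j) := by
  fin_cases j <;> rfl

/-- In the demand `k ↦ i + k + j`, receiver `i` requests file `j` and the other receiver requests
file `j + 1`. Hence receiver `i` gets the common description and file `j` from its own codeword and
cache, for both `i`, while the codeword for `i = 0` with the cache of receiver 1 reveals file `j +
1`. -/
theorem two_log_card_add_log_card_le (S : Scheme X n R₀ ρ M) (hn : 0 < n) {s : ℝ}
    (hs : Real.log 2 < s) (j : Fin 2) :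
    2 * Real.log (Fintype.card (Index n R₀ × Index n (ρ j))) +
        Real.log (Fintype.card (Index n (ρ (j + 1)))) ≤
      2 * S.costBound s + 2 * Real.log (Fintype.card (Index n M)) := by
  have hw := isSubprob_weight (n := n) (R₀ := R₀) (ρ := ρ) hs
  have hQ := hw.prod (IsSubprob.uniform (Index n M))
  have hK : (Fintype.card (Index n M) : ℝ) ≠ 0 := by exact_mod_cast Fintype.card_ne_zero
  have hdec : ∀ (i : Fin 2) {w w' : Descriptions n R₀ ρ},
      S.correctedCodeword (fun k => i + k + j) w = S.correctedCodeword (fun k => i + k + j) w' →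
      S.cache w i = S.cache w' i → w.1 = w'.1 ∧ w.2 j = w'.2 j := by
    intro i w w' hY hZ
    have h := S.eq_of_correctedCodeword_eq _ i hY hZ
    have hi : i + i + j = j := by fin_cases i <;> fin_cases j <;> rfl
    rwa [hi] at h
  have hdec' : ∀ {w w' : Descriptions n R₀ ρ},
      S.correctedCodeword (fun k => 0 + k + j) w = S.correctedCodeword (fun k => 0 + k + j) w' →
      S.cache w 1 = S.cache w' 1 → w.2 (j + 1) = w'.2 (j + 1) := by
    intro w w' hY hZ
    have h := (S.eq_of_correctedCodeword_eq _ 1 hY hZ).2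
    have hj : 0 + 1 + j = j + 1 := by fin_cases j <;> rfl
    rwa [hj] at h
  have hfst : ∀ {x y : (Index n R₀ × Index n (ρ j)) × Index n (ρ (j + 1))},
      ((groupEquiv n R₀ ρ j).symm x).1 = ((groupEquiv n R₀ ρ j).symm y).1 ∧
        ((groupEquiv n R₀ ρ j).symm x).2 j = ((groupEquiv n R₀ ρ j).symm y).2 j →
      x.1 = y.1 := by
    intro x y h
    have hx := groupEquiv_apply_fst j ((groupEquiv n R₀ ρ j).symm x)
    have hy := groupEquiv_apply_fst j ((groupEquiv n R₀ ρ j).symm y)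
    rw [Equiv.apply_symm_apply] at hx hy
    rw [hx, hy, h.1, h.2]
  have h := hQ.two_mul_log_card_add_le hQ
    (f := fun x => (S.correctedCodeword (fun k => 0 + k + j) ((groupEquiv n R₀ ρ j).symm x),
      S.cache ((groupEquiv n R₀ ρ j).symm x) 0))
    (g := fun x => (S.correctedCodeword (fun k => 1 + k + j) ((groupEquiv n R₀ ρ j).symm x),
      S.cache ((groupEquiv n R₀ ρ j).symm x) 1))
    (W := Index n R₀ × Index n (ρ j)) (V := Index n (ρ (j + 1)))
    (fun x y hf => hfst (hdec 0 (Prod.ext_iff.1 hf).1 (Prod.ext_iff.1 hf).2))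
    (fun x y hg => hfst (hdec 1 (Prod.ext_iff.1 hg).1 (Prod.ext_iff.1 hg).2))
    (fun x y hf hg => by
      have h1 := hdec 0 (Prod.ext_iff.1 hf).1 (Prod.ext_iff.1 hf).2
      have h2 := hdec' (Prod.ext_iff.1 hf).1 (Prod.ext_iff.1 hg).2
      refine (groupEquiv n R₀ ρ j).symm.injective (Prod.ext h1.1 (funext fun k => ?_))
      have hk : k = j ∨ k = j + 1 := by fin_cases j <;> fin_cases k <;> simp
      rcases hk with rfl | rfl
      exacts [h1.2, h2])
  have e : ∀ (d : Demand) (w : Descriptions n R₀ ρ),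
      -Real.log (weight n R₀ ρ s (S.correctedCodeword d w) * (Fintype.card (Index n M) : ℝ)⁻¹) =
      -Real.log (weight n R₀ ρ s (S.correctedCodeword d w)) +
        Real.log (Fintype.card (Index n M)) := by
    intro d w
    rw [Real.log_mul (hw.pos _).ne' (inv_ne_zero hK), Real.log_inv]
    ring
  rw [Equiv.sum_comp (groupEquiv n R₀ ρ j).symm fun w =>
      -Real.log (weight n R₀ ρ s (S.correctedCodeword (fun k => 0 + k + j) w) *
        (Fintype.card (Index n M) : ℝ)⁻¹) +
      -Real.log (weight n R₀ ρ s (S.correctedCodeword (fun k => 1 + k + j) w) *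
        (Fintype.card (Index n M) : ℝ)⁻¹), ← Fintype.card_congr (groupEquiv n R₀ ρ j)] at h
  simp only [e, Finset.sum_add_distrib, Finset.sum_const, Finset.card_univ, nsmul_eq_mul] at h
  refine le_of_mul_le_mul_left ?_
    (show (0 : ℝ) < Fintype.card (Descriptions n R₀ ρ) by exact_mod_cast Fintype.card_pos)
  linarith [S.sum_neg_log_weight_le hn hs fun k => 0 + k + j,
    S.sum_neg_log_weight_le hn hs fun k => 1 + k + j]

end Scheme

end GWCache

namespace GWCache

/-! ### Asymptotics -/

theorem log_card_descriptions_le (n : ℕ) (R₀ : ℝ) (ρ : Fin 2 → ℝ) :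
    Real.log (Fintype.card (Descriptions n R₀ ρ)) ≤
      n * (|R₀| + |ρ 0| + |ρ 1|) * Real.log 2 := by
  have h : ∀ r : ℝ, (⌊(n : ℝ) * r⌋₊ : ℝ) ≤ n * |r| := fun r =>
    (Nat.cast_le.2 (Nat.floor_le_floor
      (mul_le_mul_of_nonneg_left (le_abs_self r) (Nat.cast_nonneg n)))).trans
      (Nat.floor_le (by positivity))
  rw [log_card_descriptions]
  refine mul_le_mul_of_nonneg_right ?_ (Real.log_pos one_lt_two).le
  linarith [h R₀, h (ρ 0), h (ρ 1)]

variable {X : Fin 2 → Type*} [∀ j, Fintype (X j)]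

theorem AchievableWith.exists_costBound_le {p : PMF (∀ j, X j)} {R₀ : ℝ} {ρ : Fin 2 → ℝ}
    {R M : ℝ} (h : AchievableWith p R₀ ρ R M) {δ : ℝ} (hδ : 0 < δ) :
    ∃ (n : ℕ) (S : Scheme X n R₀ ρ M), 0 < n ∧ 3 ≤ n * δ ∧
      S.costBound ((1 + δ) * Real.log 2) ≤ n * Real.log 2 *
        ((1 + δ) * (R + δ) + δ + 2 * δ * (|R₀| + |ρ 0| + |ρ 1|)) := by
  obtain ⟨-, n, S, hn, -, -, herr, hrate⟩ := h
  have hl2 := Real.log_pos one_lt_two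
  have h1 : ∀ᶠ k in atTop, ((S k).peakRate (independentLaw (n k) R₀ ρ) : EReal) <
      ((R + δ : ℝ) : EReal) :=
    eventually_lt_of_limsup_lt (hrate.trans_lt (EReal.coe_lt_coe_iff.2 (by linarith)))
  have h2 : ∀ᶠ k in atTop, (S k).descrErrorProb (independentLaw (n k) R₀ ρ) < δ :=
    herr.eventually (gt_mem_nhds hδ)
  have hn' : Tendsto (fun k => (n k : ℝ)) atTop atTop :=
    tendsto_natCast_atTop_atTop.comp hn.tendsto_atTop
  set C := Real.log 2 - Real.log (1 - 2 * Real.exp (-((1 + δ) * Real.log 2)))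
  -- The block length is taken so large that `n * δ` absorbs the rounding of the rates and `n * δ *
  -- log 2` the additive constant `C`, which does not depend on `n`.
  obtain ⟨k, k1, k2, k3, k4, k5⟩ := (h1.and (h2.and ((hn'.eventually_ge_atTop (3 / δ)).and
    ((hn'.eventually_ge_atTop (C / (δ * Real.log 2))).and (hn'.eventually_ge_atTop 1))))).exists
  refine ⟨n k, S k, by exact_mod_cast k5, (div_le_iff₀ hδ).1 k3, ?_⟩
  have hk := EReal.coe_lt_coe_iff.1 k1
  rw [div_le_iff₀ (by positivity)] at k4
  have a1 : (1 + δ) * Real.log 2 * (n k * (S k).peakRate (independentLaw (n k) R₀ ρ)) ≤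
      (1 + δ) * Real.log 2 * (n k * (R + δ)) := by gcongr
  have hN : 0 ≤ Real.log (Fintype.card (Descriptions (n k) R₀ ρ)) := Real.log_natCast_nonneg _
  have a2 : 2 * (S k).descrErrorProb (independentLaw (n k) R₀ ρ) *
      Real.log (Fintype.card (Descriptions (n k) R₀ ρ)) ≤
      2 * δ * (n k * (|R₀| + |ρ 0| + |ρ 1|) * Real.log 2) :=
    mul_le_mul (by linarith) (log_card_descriptions_le _ _ _) hN (by linarith)
  rw [Scheme.costBound]
  linarith

theorem AchievableWith.rate_bounds {p : PMF (∀ j, X j)} {R₀ : ℝ} {ρ : Fin 2 → ℝ}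
    {R M : ℝ} (h : AchievableWith p R₀ ρ R M) :
    R₀ + ρ 0 + ρ 1 ≤ R + 2 * M ∧ R₀ + ρ 0 + ρ 1 ≤ 2 * R + M ∧
      ∀ j, 2 * (R₀ + ρ j) + ρ (j + 1) ≤ 2 * R + 2 * M := by
  have hl2 := Real.log_pos one_lt_two
  set T := |R₀| + |ρ 0| + |ρ 1|
  set g : ℝ → ℝ := fun δ => (1 + δ) * (R + δ) + δ + 2 * δ * T with hg
  -- As `δ` decreases to 0, `g δ` tends to `R`.
  have hlim : ∀ {a b c : ℝ}, (∀ δ > 0, a - 2 * δ ≤ b * g δ + c) → a ≤ b * R + c := by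
    intro a b c hab
    have hc : Continuous fun δ => b * g δ + c + 2 * δ := by fun_prop
    have ht := (hc.tendsto 0).mono_left (nhdsWithin_le_nhds (s := Set.Ioi 0))
    have := ge_of_tendsto ht (eventually_mem_nhdsWithin.mono fun δ hδ => by
      linarith [hab δ hδ] : ∀ᶠ δ in 𝓝[>] (0 : ℝ), a ≤ _)
    simpa [hg] using this
  -- Each floor loses at most one bit. The first two bounds involve three floors and the last one
  -- five, counted with multiplicity; since `3 ≤ n * δ`, a loss of `2 * δ` per symbol covers all
  -- cases.
  have hbd : ∀ δ > 0, R₀ + ρ 0 + ρ 1 - 2 * δ ≤ 1 * g δ + 2 * M ∧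
      R₀ + ρ 0 + ρ 1 - 2 * δ ≤ 2 * g δ + M ∧
      ∀ j, 2 * (R₀ + ρ j) + ρ (j + 1) - 2 * δ ≤ 2 * g δ + 2 * M := by
    intro δ hδ
    obtain ⟨n, S, hn, hnδ, hB⟩ := h.exists_costBound_le hδ
    have hn0 : (0 : ℝ) < n := by exact_mod_cast hn
    have hs : Real.log 2 < (1 + δ) * Real.log 2 := by nlinarith
    have hfl : ∀ r : ℝ, (n * r - 1) * Real.log 2 ≤ ⌊(n : ℝ) * r⌋₊ * Real.log 2 := fun r =>
      mul_le_mul_of_nonneg_right (Nat.sub_one_lt_floor _).le hl2.le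
    have hK : Real.log (Fintype.card (Index n M)) ≤ n * M * Real.log 2 := by
      rw [log_card_index]
      exact mul_le_mul_of_nonneg_right (Nat.floor_le (mul_nonneg hn0.le h.1)) hl2.le
    have hδl := mul_le_mul_of_nonneg_right hnδ hl2.le
    have b1 := S.log_card_le_costBound_add_two_caches hn hs
    have b2 := S.log_card_le_two_costBound_add_cache hn hs
    have b3 := S.two_log_card_add_log_card_le hn hs
    rw [log_card_descriptions] at b1 b2
    have h0 := hfl R₀
    have h1 := hfl (ρ 0)
    have h2 := hfl (ρ 1)
    have hpos := mul_pos hn0 hl2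
    have hnd : 0 < n * δ * Real.log 2 := by positivity
    refine ⟨?_, ?_, fun j => ?_⟩
    · refine le_of_mul_le_mul_left ?_ hpos
      linarith
    · refine le_of_mul_le_mul_left ?_ hpos
      linarith
    · have b := b3 j
      rw [Fintype.card_prod, Nat.cast_mul, Real.log_mul (by exact_mod_cast Fintype.card_ne_zero)
        (by exact_mod_cast Fintype.card_ne_zero), log_card_index, log_card_index,
        log_card_index] at b
      refine le_of_mul_le_mul_left ?_ hpos
      linarith [hfl (ρ j), hfl (ρ (j + 1))]
  refine ⟨?_, hlim fun δ hδ => (hbd δ hδ).2.1, fun j => hlim fun δ hδ => (hbd δ hδ).2.2 j⟩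
  simpa using hlim fun δ hδ => (hbd δ hδ).1

end GWCache

/-! ### Passage to the closed region -/

theorem theorem2 {X : Fin 2 → Type*} [∀ j, Fintype (X j)] {U : Type*} [Fintype U]
    (p : PMF (∀ j, X j)) (κ : (∀ j, X j) → PMF U) (M : ℝ) (hM : 0 ≤ M) :
    (GWCache.lowerBound p κ M : EReal) ≤ GWCache.rateMemoryFunction p κ M := by
  refine le_sInf ?_
  rintro _ ⟨R, hR, rfl⟩
  -- The infimum defining `lowerBound` is real, so boundedness below is required; the first
  -- inequality supplies it.
  refine EReal.coe_le_coe_iff.2 (csInf_le ⟨_, fun _ h => h.1⟩ ?_)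
  set I := GWCache.infoXU p κ
  set H₀ := GWCache.entXgivenU p κ 0
  set H₁ := GWCache.entXgivenU p κ 1
  let C : Set (ℝ × ℝ) := {a | I + H₀ + H₁ - 2 * a.2 ≤ a.1 ∧ 1 / 2 * (I + H₀ + H₁ - a.2) ≤ a.1 ∧
    I + H₀ + 1 / 2 * H₁ - a.2 ≤ a.1 ∧ I + 1 / 2 * H₀ + H₁ - a.2 ≤ a.1}
  have hC : IsClosed C := by
    simp only [C, Set.ofPred_and]
    exact (isClosed_le (by fun_prop) (by fun_prop)).inter <|
      (isClosed_le (by fun_prop) (by fun_prop)).inter <|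
        (isClosed_le (by fun_prop) (by fun_prop)).inter
          (isClosed_le (by fun_prop) (by fun_prop))
  suffices hsub : GWCache.rateMemoryRegion p κ ⊆ C from hsub hR
  refine closure_minimal ?_ hC
  rintro ⟨R', M'⟩ ⟨⟨R₀, ρ⟩, ⟨hI, hH⟩, hach⟩
  obtain ⟨h1, h2, h3⟩ := hach.rate_bounds
  have h30 := h3 0
  have h31 := h3 1
  have hH0 : H₀ ≤ ρ 0 := hH 0
  have hH1 : H₁ ≤ ρ 1 := hH 1
  simp only [zero_add, show (1 : Fin 2) + 1 = 0 from rfl] at h1 h2 h30 h31 hI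
  refine ⟨?_, ?_, ?_, ?_⟩ <;> dsimp only <;> linarith
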